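/- All rings are associative with unit. A ring is left perfect if every left module over it has a projective cover. Let $\mathfrak R$ be a complete, separated topological ring with a base of neighborhoods of zero formed by open two-sided ideals, and suppose that for every open two-sided ideal $\mathfrak I\subset\mathfrak R$ the discrete quotient ring $\mathfrak R/\mathfrak I$ is left perfect. Assume that at least one of the following holds: (a) $\mathfrak R$ is commutative; (b) $\mathfrak R$ has a countable base of neighborhoods of zero; (c) there are only finitely many open two-sided ideals $\mathfrak I\subset\mathfrak R$ for which $\mathfrak R/\mathfrak I$ is semisimple Artinian. Let $H(R)$ denote the Jacobson radical of a ring $R$, and let $\mathfrak H=\varprojlim_{\mathfrak I}H(\mathfrak R/\mathfrak I)\subset\varprojlim_{\mathfrak I}\mathfrak R/\mathfrak I=\mathfrak R$, the limit being over all open two-sided ideals $\mathfrak I$; that is, $\mathfrak H$ consists of the elements of $\mathfrak R$ whose image in each $\mathfrak R/\mathfrak I$ lies in $H(\mathfrak R/\mathfrak I)$. Then: 1. $\mathfrak H$ is a two-sided ideal, and it is topologically left T-nilpotent: for every sequence $a_1,a_2,a_3,\dots$ in $\mathfrak H$, the sequence $a_1,\ a_1a_2,\ a_1a_2a_3,\dots$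 converges to zero in $\mathfrak R$. 2. $\mathfrak H$ is strongly closed in $\mathfrak R$: it is closed, the quotient $\mathfrak R/\mathfrak H$ is complete in the quotient topology, and for every set $X$ every family $(q_x)_{x\in X}$ in $\mathfrak R/\mathfrak H$ converging to zero (each neighborhood of zero contains $q_x$ for all but finitely many $x$) lifts to a family $(a_x)_{x\in X}$ in $\mathfrak R$ converging to zero. 3. $\mathfrak R/\mathfrak H$ with the quotient topology is isomorphic, as a topological ring, to a product $\prod_{\gamma\in\Gamma}S_\gamma$ of simple Artinian discrete rings with the product topology. 4. Suppose $\mathfrak R$ is commutative. Let $\Gamma$ be the set of open ideals $\mathfrak G\subset\mathfrak R$ such that $\mathfrak R/\mathfrak G$ is a field. For $\mathfrak G\in\Gamma$ let $\mathfrak R_{\mathfrak G}=\varprojlim_{\mathfrak J}\mathfrak R/\mathfrak J$ with the projective limit topology, the limit being over all open ideals $\mathfrak J\subset\mathfrak G$ for which $\mathfrak R/\mathfrak J$ is a local ring, and let $\mathfrak H_{\mathfrak G}$ be the kernel of the natural homomorphism $\mathfrak R_{\mathfrak G}\to\mathfrak R/\mathfrak G$. Then each $\mathfrak R_{\mathfrak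 G}$ is a local ring; the natural ring homomorphism $\mathfrak R\to\prod_{\mathfrak G\in\Gamma}\mathfrak R_{\mathfrak G}$ is an isomorphism of topological rings (for the product topology) and maps $\mathfrak H$ onto $\prod_{\mathfrak G\in\Gamma}\mathfrak H_{\mathfrak G}$; and the natural maps $\mathfrak R/\mathfrak H\to\mathfrak R/\mathfrak G$ induce an isomorphism of topological rings $\mathfrak R/\mathfrak H\cong\prod_{\mathfrak G\in\Gamma}\mathfrak R/\mathfrak G$, where the fields $\mathfrak R/\mathfrak G$ are discrete. -/

import Mathlib

open Filter Topology

universe w u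

/-- A projective cover in the category of left `R`-modules: an epimorphism `p : P → M` with `P`
projective such that every endomorphism `e` of `P` with `p ∘ e = p` is an automorphism. -/
def IsProjectiveCover {R : Type u} [Ring R] {P M : Type u} [AddCommGroup P] [Module R P]
    [AddCommGroup M] [Module R M] (p : P →ₗ[R] M) : Prop :=
  Module.Projective R P ∧ Function.Surjective p ∧
    ∀ e : P →ₗ[R] P, p ∘ₗ e = p → Function.Bijective e

/-- A ring is left perfect if every left module over it has a projective cover. -/
def IsLeftPerfect (R : Type u) [Ring R] : Prop :=
  ∀ (M : Type u) [AddCommGroup M] [Module R M],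
    ∃ (P : Type u) (_ : AddCommGroup P) (_ : Module R P) (p : P →ₗ[R] M), IsProjectiveCover p

/-- A closed subgroup `H` of a (complete, separated) topological abelian group `A` is strongly
closed if `A ⧸ H` is complete in the quotient topology and every family of elements of `A ⧸ H`
converging to zero lifts to a family of elements of `A` converging to zero, that is, the induced
map `A[[X]] → (A ⧸ H)[[X]]` is surjective for every set `X`. A family `(a x)` converges to zero
if every neighborhood of zero contains `a x` for all but finitely many `x`. -/
structure IsStronglyClosed {A : Type u} [AddCommGroup A] [TopologicalSpace A]
    [IsTopologicalAddGroup A] (H : AddSubgroup A) : Prop where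
  isClosed : IsClosed (H : Set A)
  complete : @CompleteSpace (A ⧸ H) (IsTopologicalAddGroup.rightUniformSpace (A ⧸ H))
  exists_lift : ∀ (X : Type w) (q : X → A ⧸ H), Tendsto q cofinite (𝓝 0) →
    ∃ a : X → A, Tendsto a cofinite (𝓝 0) ∧ ∀ x, (a x : A ⧸ H) = q x

/-- Left T-nilpotency in the topological sense: for every sequence `a₀, a₁, a₂, …` in `H`, the
products `a₀, a₀ a₁, a₀ a₁ a₂, …` converge to zero. -/
def IsTopologicallyLeftTNilpotent {R : Type u} [Ring R] [TopologicalSpace R] (H : Ideal R) :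
    Prop :=
  ∀ a : ℕ → R, (∀ n, a n ∈ H) →
    Tendsto (fun n : ℕ => ((List.range (n + 1)).map a).prod) atTop (𝓝 0)

/-- The open two-sided ideals `I` of a topological ring; the discrete quotient rings of `R` are
the rings `R ⧸ I`. -/
abbrev OpenIdeal (R : Type u) [Ring R] [TopologicalSpace R] : Type u :=
  {I : Ideal R // I.IsTwoSided ∧ IsOpen (I : Set R)}

instance OpenIdeal.isTwoSided {R : Type u} [Ring R] [TopologicalSpace R] (I : OpenIdeal R) :
    I.1.IsTwoSided := I.2.1

/-- The projective limit of the Jacobson radicals of the discrete quotient rings `R ⧸ I`, as a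
subset of `R = lim R ⧸ I`: the elements whose image in every `R ⧸ I` lies in the Jacobson radical
of `R ⧸ I`. -/
def limJacobson (R : Type u) [Ring R] [TopologicalSpace R] : Ideal R :=
  ⨅ I : OpenIdeal R, (Ring.jacobson (R ⧸ I.1)).comap (Ideal.Quotient.mk I.1)

instance limJacobson.isTwoSided (R : Type u) [Ring R] [TopologicalSpace R] :
    (limJacobson R).IsTwoSided := by
  unfold limJacobson; infer_instance

/-- The open ideals `G` such that `R ⧸ G` is a field. -/
abbrev OpenFieldIdeal (R : Type u) [Ring R] [TopologicalSpace R] : Type u :=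
  {G : OpenIdeal R // IsField (R ⧸ G.1)}

/-- The open ideals `J ⊆ G` such that `R ⧸ J` is a local ring. -/
abbrev OpenLocalIdeal {R : Type u} [Ring R] [TopologicalSpace R] (G : OpenFieldIdeal R) : Type u :=
  {J : OpenIdeal R // IsLocalRing (R ⧸ J.1) ∧ J.1 ≤ G.1.1}

theorem isLocalRing_of_isField_aux {K : Type u} [Ring K] (h : IsField K) : IsLocalRing K :=
  letI := h.toField
  inferInstanceAs (IsLocalRing K)

/-- `G` itself, as an open ideal contained in `G` with local quotient. -/
def OpenLocalIdeal.self {R : Type u} [Ring R] [TopologicalSpace R] (G : OpenFieldIdeal R) :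
    OpenLocalIdeal G :=
  ⟨G.1, isLocalRing_of_isField_aux G.2, le_rfl⟩

/-- The projective limit `R_G` of the discrete local rings `R ⧸ J` over the open ideals `J ⊆ G`
with `R ⧸ J` local, with the projective limit topology (induced from the product). -/
def LocalPiece {R : Type u} [Ring R] [TopologicalSpace R] (G : OpenFieldIdeal R) :
    Subring (∀ J : OpenLocalIdeal G, R ⧸ J.1.1) where
  carrier := {x | ∀ (J J' : OpenLocalIdeal G) (h : J.1.1 ≤ J'.1.1),
    Ideal.Quotient.factor h (x J) = x J'}
  mul_mem' hx hy J J' h := by simp [hx J J' h, hy J J' h]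
  one_mem' J J' h := by simp
  add_mem' hx hy J J' h := by simp [hx J J' h, hy J J' h]
  zero_mem' J J' h := by simp
  neg_mem' hx J J' h := by simp [hx J J' h]

/-- The natural ring homomorphism `R → R_G`. -/
def toLocalPiece {R : Type u} [Ring R] [TopologicalSpace R] (G : OpenFieldIdeal R) :
    R →+* LocalPiece G :=
  (RingHom.pi fun J : OpenLocalIdeal G => Ideal.Quotient.mk J.1.1).codRestrict (LocalPiece G)
    (fun _ _ _ h => Ideal.Quotient.factor_mk h _)

/-- The kernel `H_G` of the natural ring homomorphism `R_G → R ⧸ G`. -/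
def LocalPiece.residueKernel {R : Type u} [Ring R] [TopologicalSpace R] (G : OpenFieldIdeal R) :
    Ideal (LocalPiece G) :=
  RingHom.ker
    ((Pi.evalRingHom (fun J : OpenLocalIdeal G => R ⧸ J.1.1) (OpenLocalIdeal.self G)).comp
      (LocalPiece G).subtype)

/-- The natural ring homomorphism from `R` to the product of the rings `R_G` over all open ideals
`G` such that `R ⧸ G` is a field. -/
def toLocalPieces (R : Type u) [Ring R] [TopologicalSpace R] :
    R →+* ∀ G : OpenFieldIdeal R, LocalPiece G :=
  RingHom.pi fun G => toLocalPiece G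

/-!
Write `π : R → ∏ R ⧸ G` for the product of the projections onto the discrete quotient rings
`R ⧸ G`, where `G` runs over the open two-sided ideals with `R ⧸ G` simple. Its kernel is
`limJacobson R`, because the semisimple ring `R ⧸ I.jacobson` is a finite product of such `R ⧸ G`
for every open `I`. Everything about `R ⧸ limJacobson R` follows once `π` is known to be an open
quotient map with a set-theoretic section that is continuous at zero.

* If there are only finitely many `G`, this is the Chinese remainder theorem, the product being
  discrete.
* If `R` has a countable base at zero, successive approximation along a decreasing base of open
  ideals lifts a point of the product whose coordinates vanish at all `G ⊇ I` to an element of `I`.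
  A correction in `I` exists at each step since `I.jacobson = K.jacobson ⊔ I` for `K ≤ I`.
* If `R` is commutative, `toLocalPieces R` is a topological embedding with dense and, by
  completeness, closed image, and `π` is its composition with the product of the residue maps
  `R_G → R ⧸ G` onto discrete fields.

Topological T-nilpotence is Bass's theorem for the rings `R ⧸ I`: if all `a n` lie in the radical,
the direct limit `M` of `R → R → ⋯` along the right multiplications by `a n` satisfies
`Ring.jacobson R • M = M`, so its projective cover, hence `M` itself, vanishes.
-/

section LeftPerfect

variable {R : Type u} [Ring R]

/-- A superfluous (or small) submodule: it cannot be completed to the whole module by a proper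
submodule. Kernels of projective covers have this property. -/
def IsSuperfluous {P : Type*} [AddCommGroup P] [Module R P] (K : Submodule R P) : Prop :=
  ∀ L : Submodule R P, L ⊔ K = ⊤ → L = ⊤

theorem IsSuperfluous.map {P M : Type*} [AddCommGroup P] [Module R P] [AddCommGroup M] [Module R M]
    {K : Submodule R P} (hK : IsSuperfluous K) (f : P →ₗ[R] M) : IsSuperfluous (K.map f) := by
  intro L hL
  have hcomap : L.comap f = ⊤ := by
    refine hK _ (eq_top_iff.2 fun x _ => ?_)
    obtain ⟨l, hl, _, ⟨k, hk, rfl⟩, hx⟩ :=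
      Submodule.mem_sup.1 (hL ▸ Submodule.mem_top : f x ∈ L ⊔ K.map f)
    refine Submodule.mem_sup.2 ⟨x - k, ?_, k, hk, sub_add_cancel x k⟩
    rwa [Submodule.mem_comap, map_sub, ← hx, add_sub_cancel_right]
  have hle : K.map f ≤ L := Submodule.map_le_iff_le_comap.2 (hcomap ▸ le_top)
  rwa [sup_eq_left.2 hle] at hL

theorem IsSuperfluous.le_jacobson {P : Type*} [AddCommGroup P] [Module R P] {K : Submodule R P}
    (hK : IsSuperfluous K) : K ≤ Module.jacobson R P := by
  refine le_sInf fun m hm => ?_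
  by_contra hKm
  exact hm.1 (hK m (hm.2 _ (left_lt_sup.2 hKm)))

theorem IsProjectiveCover.isSuperfluous_ker {P M : Type u} [AddCommGroup P] [Module R P]
    [AddCommGroup M] [Module R M] {p : P →ₗ[R] M} (hp : IsProjectiveCover p) :
    IsSuperfluous (LinearMap.ker p) := by
  obtain ⟨hproj, hsurj, hend⟩ := hp
  intro L hL
  have hpL : Function.Surjective (p ∘ₗ L.subtype) := by
    rw [← LinearMap.range_eq_top, LinearMap.range_comp, Submodule.range_subtype,
      LinearMap.map_eq_top_iff (LinearMap.range_eq_top.2 hsurj), hL]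
  obtain ⟨e, he⟩ := Module.projective_lifting_property _ p hpL
  have hbij := hend (L.subtype ∘ₗ e) (by rw [← LinearMap.comp_assoc, he])
  refine eq_top_iff.2 fun x _ => ?_
  obtain ⟨y, rfl⟩ := hbij.2 x
  exact (e y).2

/-- The projective cover of `R ⧸ I` splits off `R`, and the complementary left ideal meets `I` in
the image of the kernel of the cover. -/
theorem IsLeftPerfect.exists_sup_eq_top_inf_le_jacobson (h : IsLeftPerfect R) (I : Ideal R) :
    ∃ L : Ideal R, I ⊔ L = ⊤ ∧ I ⊓ L ≤ Ring.jacobson R := by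
  obtain ⟨P, _, _, p, hp⟩ := h (R ⧸ I)
  have := hp.1
  obtain ⟨φ, hφ⟩ := Module.projective_lifting_property p I.mkQ hp.2.1
  have hφsurj : Function.Surjective φ := by
    have hmap : (LinearMap.range φ).map p = ⊤ := by
      rw [← LinearMap.range_comp, hφ, I.range_mkQ]
    exact LinearMap.range_eq_top.1 (hp.isSuperfluous_ker _
      ((LinearMap.map_eq_top_iff (LinearMap.range_eq_top.2 hp.2.1)).1 hmap))
  obtain ⟨s, hs⟩ := Module.projective_lifting_property φ LinearMap.id hφsurj
  have hφs (x) : φ (s x) = x := LinearMap.congr_fun hs x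
  have hmem_iff (x) : x ∈ I ↔ p (φ x) = 0 := by
    rw [← LinearMap.comp_apply, hφ, Submodule.mkQ_apply, Submodule.Quotient.mk_eq_zero]
  refine ⟨LinearMap.range s, eq_top_iff.2 fun x _ => ?_, ?_⟩
  · refine Submodule.mem_sup.2 ⟨x - s (φ x), ?_, s (φ x), ⟨_, rfl⟩, sub_add_cancel _ _⟩
    rw [hmem_iff, map_sub, hφs, sub_self, map_zero]
  · rintro _ ⟨hI, y, rfl⟩
    refine (hp.isSuperfluous_ker.map s).le_jacobson ⟨y, ?_, rfl⟩
    rwa [SetLike.mem_coe, hmem_iff, hφs] at hI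

theorem IsLeftPerfect.isSemisimpleRing_quotient_jacobson (h : IsLeftPerfect R) :
    IsSemisimpleRing (R ⧸ Ring.jacobson R) := by
  refine (isSemisimpleModule_iff _ _).2 ⟨fun I => ?_⟩
  have hsurj := Ideal.Quotient.mk_surjective (I := Ring.jacobson R)
  obtain ⟨L, hsup, hinf⟩ :=
    h.exists_sup_eq_top_inf_le_jacobson (Ideal.comap (Ideal.Quotient.mk _) I)
  refine ⟨L.map (Ideal.Quotient.mk _), ?_, ?_⟩
  · rw [Submodule.disjoint_def]
    intro x hx hxL
    obtain ⟨l, hl, rfl⟩ := (Ideal.mem_map_iff_of_surjective _ hsurj).1 hxL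
    exact Ideal.Quotient.eq_zero_iff_mem.2 (hinf ⟨hx, hl⟩)
  · rw [codisjoint_iff, ← Ideal.map_comap_of_surjective _ hsurj I, ← Ideal.map_sup, hsup,
      Ideal.map_top]

theorem IsLeftPerfect.exists_sub_mul_mul_mem_jacobson (h : IsLeftPerfect R) (s : R) :
    ∃ t, s - s * t * s ∈ Ring.jacobson R := by
  obtain ⟨L, hsup, hinf⟩ := h.exists_sup_eq_top_inf_le_jacobson (Ideal.span {s})
  obtain ⟨_, hx, l, hl, hxl⟩ := Submodule.mem_sup.1 ((Ideal.eq_top_iff_one _).1 hsup)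
  obtain ⟨t, rfl⟩ := Ideal.mem_span_singleton'.1 hx
  refine ⟨t, hinf ⟨?_, ?_⟩⟩
  · exact Ideal.mem_span_singleton'.2 ⟨1 - s * t, by rw [sub_mul, one_mul]⟩
  · have hsl : s - s * t * s = s * l := by rw [eq_sub_of_add_eq' hxl, mul_sub, mul_one, mul_assoc]
    exact hsl ▸ L.mul_mem_left s hl

theorem exists_mul_one_sub_eq_one_of_mem_jacobson {x : R} (hx : x ∈ Ring.jacobson R) :
    ∃ y, y * (1 - x) = 1 := by
  rw [← Ideal.jacobson_bot] at hx
  obtain ⟨y, hy⟩ := Ideal.exists_mul_sub_mem_of_sub_one_mem_jacobson (1 - x) <| by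
    rwa [sub_sub_cancel_left, neg_mem_iff]
  exact ⟨y, sub_eq_zero.1 hy⟩

theorem isUnit_one_sub_of_mem_jacobson {x : R} (hx : x ∈ Ring.jacobson R) : IsUnit (1 - x) := by
  obtain ⟨y, hy⟩ := exists_mul_one_sub_eq_one_of_mem_jacobson hx
  obtain ⟨z, hz⟩ := exists_mul_one_sub_eq_one_of_mem_jacobson
    (neg_mem ((Ring.jacobson R).mul_mem_left y hx))
  have hzy : z * y = 1 := by
    rw [← hz, ← hy]
    noncomm_ring
  exact ⟨⟨1 - x, y, by rwa [← left_inv_eq_right_inv hzy hy], hy⟩, rfl⟩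

/-- Matrices over the radical lie in the radical of the matrix ring, so `1 - C` is invertible. -/
theorem eq_zero_of_vecMul_eq_self {n : Type*} [Fintype n] {C : Matrix n n R}
    (hC : ∀ i j, C i j ∈ Ring.jacobson R) {r : n → R} (hr : Matrix.vecMul r C = r) : r = 0 := by
  classical
  have hCjac : C ∈ Ring.jacobson (Matrix n n R) := by
    rw [← Ideal.jacobson_bot, ← Ideal.matrix_bot]
    refine Ideal.matrix_jacobson_le _ fun i j => ?_
    rw [Ideal.jacobson_bot]
    exact hC i j
  obtain ⟨U, hU⟩ := isUnit_one_sub_of_mem_jacobson hCjac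
  have hvec : Matrix.vecMul r (1 - C) = 0 := by
    rw [Matrix.vecMul_sub, Matrix.vecMul_one, hr, sub_self]
  calc r = Matrix.vecMul (Matrix.vecMul r (1 - C)) ↑U⁻¹ := by
        rw [Matrix.vecMul_vecMul, ← hU, U.mul_inv, Matrix.vecMul_one]
    _ = 0 := by rw [hvec, Matrix.zero_vecMul]

/-- The coordinates of `q : P` in a free module containing `P` as a direct summand form a row vector
fixed by a matrix over the radical. -/
theorem subsingleton_of_projective_of_jacobson_smul_eq_top {P : Type*} [AddCommGroup P]
    [Module R P] [Module.Projective R P] (hP : Ring.jacobson R • (⊤ : Submodule R P) = ⊤) :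
    Subsingleton P := by
  obtain ⟨s, hs⟩ := ‹Module.Projective R P›.out
  have hcoord (x y : P) : s x y ∈ Ring.jacobson R := by
    have hx : s x y ∈ (Ring.jacobson R • ⊤ : Submodule R P).map (Finsupp.lapply y ∘ₗ s) :=
      ⟨x, hP.ge Submodule.mem_top, rfl⟩
    rw [Submodule.map_smul''] at hx
    exact Submodule.smul_le.2 (fun c hc r _ => Ideal.mul_mem_right r _ hc) hx
  refine subsingleton_of_forall_eq 0 fun q => ?_
  have hexpand (y : P) : s q y = ∑ x ∈ (s q).support, s q x * s x y := by
    conv_lhs => rw [← hs q, Finsupp.linearCombination_apply, Finsupp.sum, map_sum]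
    simp only [id, map_smul, Finsupp.finsetSum_apply, Finsupp.smul_apply, smul_eq_mul]
  let C : Matrix (s q).support (s q).support R := fun x y => s x y
  have hfix : Matrix.vecMul (fun x : (s q).support => s q x) C =
      fun y : (s q).support => s q y := by
    ext y
    rw [hexpand]
    exact Finset.sum_coe_sort (s q).support fun x => s q x * s x y
  have hzero := eq_zero_of_vecMul_eq_self (C := C) (fun x y => hcoord x y) hfix
  have hsq : s q = 0 := by
    by_contra hne
    obtain ⟨y, hy⟩ := Finsupp.support_nonempty_iff.2 hne
    exact Finsupp.mem_support_iff.1 hy (congrFun hzero ⟨y, hy⟩)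
  rw [← hs q, hsq, map_zero]

theorem IsLeftPerfect.subsingleton_of_jacobson_smul_eq_top (h : IsLeftPerfect R) {M : Type u}
    [AddCommGroup M] [Module R M] (hM : Ring.jacobson R • (⊤ : Submodule R M) = ⊤) :
    Subsingleton M := by
  obtain ⟨P, _, _, p, hp⟩ := h M
  have := hp.1
  have hP : Ring.jacobson R • (⊤ : Submodule R P) = ⊤ := by
    have hrange := LinearMap.range_eq_top.2 hp.2.1
    refine hp.isSuperfluous_ker _ ((LinearMap.map_eq_top_iff hrange).1 ?_)
    rw [Submodule.map_smul'', Submodule.map_top, hrange, hM]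
  have := subsingleton_of_projective_of_jacobson_smul_eq_top hP
  exact hp.2.1.subsingleton

end LeftPerfect

section Bass

variable {R : Type u} [Ring R]

/-- The transition maps of the directed system `R → R → R → ⋯` whose `n`-th map is the right
multiplication by `a n`, as in Bass's proof that the radical of a left perfect ring is left
T-nilpotent. -/
def bassMap (a : ℕ → R) (i j : ℕ) (_ : i ≤ j) : R →ₗ[R] R :=
  LinearMap.toSpanSingleton R R ((List.range' i (j - i)).map a).prod

instance bassMap.directedSystem (a : ℕ → R) :
    DirectedSystem (fun _ : ℕ => R) fun i j h => bassMap a i j h where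
  map_self i x := by simp [bassMap]
  map_map k j i hij hjk x := by
    have hrange : List.range' i (j - i) ++ List.range' j (k - j) = List.range' i (k - i) := by
      rw [← Nat.sub_add_sub_cancel hjk hij, add_comm, ← List.range'_append_1,
        Nat.add_sub_cancel' hij]
    simp [bassMap, ← hrange, mul_assoc]

theorem jacobson_smul_directLimit_bassMap {a : ℕ → R} (ha : ∀ n, a n ∈ Ring.jacobson R) :
    Ring.jacobson R • (⊤ : Submodule R (Module.DirectLimit (fun _ : ℕ => R) (bassMap a))) = ⊤ := by
  refine eq_top_iff.2 fun m _ => ?_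
  obtain ⟨n, r, rfl⟩ := Module.DirectLimit.exists_of m
  have hstep : bassMap a n (n + 1) n.le_succ r = (r * a n) • 1 := by simp [bassMap]
  rw [← Module.DirectLimit.of_f (hij := n.le_succ), hstep, map_smul]
  exact Submodule.smul_mem_smul (Ideal.mul_mem_left _ r (ha n)) Submodule.mem_top

theorem IsLeftPerfect.exists_prod_eq_zero (h : IsLeftPerfect R) {a : ℕ → R}
    (ha : ∀ n, a n ∈ Ring.jacobson R) : ∃ n, ((List.range n).map a).prod = 0 := by
  have hsub := h.subsingleton_of_jacobson_smul_eq_top (jacobson_smul_directLimit_bassMap ha)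
  obtain ⟨n, h0n, hn⟩ := Module.DirectLimit.of.zero_exact (Subsingleton.elim
    (Module.DirectLimit.of R ℕ (fun _ => R) (bassMap a) 0 1) 0)
  exact ⟨n, by simpa [bassMap, List.range_eq_range'] using hn⟩

end Bass

section TwoSidedIdeals

variable {R : Type u} [Ring R]

instance isTwoSided_sup (I J : Ideal R) [I.IsTwoSided] [J.IsTwoSided] : (I ⊔ J).IsTwoSided := by
  refine ⟨fun {a} b ha => ?_⟩
  obtain ⟨x, hx, y, hy, rfl⟩ := Submodule.mem_sup.1 ha
  rw [add_mul]
  exact Submodule.add_mem_sup (I.mul_mem_right b hx) (J.mul_mem_right b hy)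

theorem exists_forall_sub_mem_of_pairwise_sup_eq_top {ι : Type*} [Finite ι] {I : ι → Ideal R}
    [∀ i, (I i).IsTwoSided] (hI : Pairwise fun i j => I i ⊔ I j = ⊤) (x : ι → R) :
    ∃ r, ∀ i, r - x i ∈ I i := by
  classical
  cases nonempty_fintype ι
  have hidem (i : ι) : ∃ e, 1 - e ∈ I i ∧ ∀ j ≠ i, e ∈ I j := by
    have htop : I i ⊔ ⨅ j ∈ ({i} : Finset ι)ᶜ, I j = ⊤ :=
      Ideal.sup_iInf_eq_top fun j hj => hI (by simpa [eq_comm] using hj)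
    obtain ⟨u, hu, e, he, hue⟩ := Submodule.mem_sup.1 ((Ideal.eq_top_iff_one _).1 htop)
    simp only [Finset.mem_compl, Finset.mem_singleton, Submodule.mem_iInf] at he
    exact ⟨e, by rwa [← hue, add_sub_cancel_right], he⟩
  choose e he₁ he₀ using hidem
  refine ⟨∑ i, x i * e i, fun j => ?_⟩
  have hsplit : ∑ i, x i * e i - x j = ∑ i ∈ {j}ᶜ, x i * e i - x j * (1 - e j) := by
    rw [Fintype.sum_eq_add_sum_compl j]
    noncomm_ring
  rw [hsplit]
  refine sub_mem (sum_mem fun i hi => (I j).mul_mem_left _ (he₀ i j ?_))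
    ((I j).mul_mem_left _ (he₁ j))
  simpa [eq_comm] using hi

theorem eq_or_eq_top_of_isSimpleRing_quotient {M N : Ideal R} [M.IsTwoSided] [N.IsTwoSided]
    (hM : IsSimpleRing (R ⧸ M)) (hMN : M ≤ N) : N = M ∨ N = ⊤ := by
  have hsurj := Ideal.Quotient.mk_surjective (I := M)
  have hcomap : (N.map (Ideal.Quotient.mk M)).comap (Ideal.Quotient.mk M) = N := by
    rw [Ideal.comap_map_of_surjective' _ hsurj, Ideal.mk_ker, sup_eq_left.2 hMN]
  rw [← hcomap]
  refine ((isSimpleRing_iff_isTwoSided_imp.1 hM).2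
    (N.map (Ideal.Quotient.mk M)) inferInstance).imp (fun h => ?_) fun h => ?_
  · rw [h, ← RingHom.ker_eq_comap_bot, Ideal.mk_ker]
  · rw [h, Ideal.comap_top]

theorem sup_eq_top_of_isSimpleRing_quotient {M N : Ideal R} [M.IsTwoSided] [N.IsTwoSided]
    (hM : IsSimpleRing (R ⧸ M)) (hN : IsSimpleRing (R ⧸ N)) (hne : M ≠ N) : M ⊔ N = ⊤ := by
  rcases eq_or_eq_top_of_isSimpleRing_quotient hM (le_sup_left : M ≤ M ⊔ N) with hsupM | htop
  · rcases eq_or_eq_top_of_isSimpleRing_quotient hN (le_sup_right : N ≤ M ⊔ N) with hsupN | htop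
    · exact absurd (hsupM.symm.trans hsupN) hne
    · exact htop
  · exact htop

theorem ne_top_of_isSimpleRing_quotient {M : Ideal R} [M.IsTwoSided] (hM : IsSimpleRing (R ⧸ M)) :
    M ≠ ⊤ :=
  have := hM
  Ideal.Quotient.nontrivial_iff.1 inferInstance

theorem jacobson_eq_self_of_isSimpleRing_quotient {M : Ideal R} [M.IsTwoSided]
    (hM : IsSimpleRing (R ⧸ M)) : M.jacobson = M :=
  (eq_or_eq_top_of_isSimpleRing_quotient hM M.le_jacobson).resolve_right fun h =>
    ne_top_of_isSimpleRing_quotient hM (Ideal.jacobson_eq_top_iff.1 h)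

/-- The two-sided ideals `M ⊇ N` with simple quotient ring, that is, the maximal two-sided ideals
containing `N`. -/
def simpleQuotientIdeals (N : Ideal R) : Set (Ideal R) :=
  {M | N ≤ M ∧ ∃ _ : M.IsTwoSided, IsSimpleRing (R ⧸ M)}

/-- The kernels of the projections of `R ⧸ N` to its Wedderburn components. -/
theorem exists_iInf_eq_of_isSemisimpleRing_quotient (N : Ideal R) [N.IsTwoSided]
    [IsSemisimpleRing (R ⧸ N)] :
    ∃ (n : ℕ) (M : Fin n → Ideal R), (∀ i, M i ∈ simpleQuotientIdeals N) ∧ ⨅ i, M i = N := by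
  obtain ⟨n, D, d, _, _, ⟨e⟩⟩ := IsSemisimpleRing.exists_ringEquiv_pi_matrix_divisionRing (R ⧸ N)
  let f (i) : R →+* Matrix (Fin (d i)) (Fin (d i)) (D i) :=
    ((Pi.evalRingHom _ i).comp e.toRingHom).comp (Ideal.Quotient.mk N)
  have hf (i) : Function.Surjective (f i) :=
    ((Function.surjective_eval i).comp e.surjective).comp Ideal.Quotient.mk_surjective
  have hinf : ⨅ i, RingHom.ker (f i) = N := by
    ext x
    simp only [Submodule.mem_iInf, RingHom.mem_ker]
    rw [← Ideal.Quotient.eq_zero_iff_mem, ← map_eq_zero_iff e e.injective, funext_iff]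
    rfl
  refine ⟨n, fun i => RingHom.ker (f i), fun i => ⟨hinf ▸ iInf_le _ i, inferInstance, ?_⟩, hinf⟩
  exact .of_ringEquiv (RingHom.quotientKerEquivOfSurjective (hf i)).symm inferInstance

theorem sInf_simpleQuotientIdeals (N : Ideal R) [N.IsTwoSided] [IsSemisimpleRing (R ⧸ N)] :
    sInf (simpleQuotientIdeals N) = N := by
  obtain ⟨n, M, hM, hinf⟩ := exists_iInf_eq_of_isSemisimpleRing_quotient N
  refine le_antisymm (le_trans (le_iInf fun i => sInf_le (hM i)) hinf.le) (le_sInf fun _ h => h.1)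

theorem finite_simpleQuotientIdeals (N : Ideal R) [N.IsTwoSided] [IsSemisimpleRing (R ⧸ N)] :
    (simpleQuotientIdeals N).Finite := by
  obtain ⟨n, M, hM, hinf⟩ := exists_iInf_eq_of_isSemisimpleRing_quotient N
  have htwo (i) : (M i).IsTwoSided := (hM i).2.1
  refine (Set.finite_range M).subset fun G ⟨hNG, _, hG⟩ => ?_
  by_contra hne
  have hsup : G ⊔ ⨅ i ∈ Finset.univ, M i = ⊤ := Ideal.sup_iInf_eq_top fun i _ =>
    sup_eq_top_of_isSimpleRing_quotient hG (hM i).2.2 fun h => hne ⟨i, h.symm⟩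
  simp only [Finset.mem_univ, iInf_true, hinf, sup_eq_left.2 hNG] at hsup
  exact ne_top_of_isSimpleRing_quotient hG hsup

theorem comap_mk_ringJacobson (I : Ideal R) [I.IsTwoSided] :
    (Ring.jacobson (R ⧸ I)).comap (Ideal.Quotient.mk I) = I.jacobson := by
  rw [← Ideal.jacobson_bot, Ideal.comap_jacobson_of_surjective Ideal.Quotient.mk_surjective,
    ← RingHom.ker_eq_comap_bot, Ideal.mk_ker]

theorem simpleQuotientIdeals_jacobson (I : Ideal R) :
    simpleQuotientIdeals I.jacobson = simpleQuotientIdeals I := by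
  ext M
  refine and_congr_left fun ⟨_, hM⟩ => ⟨I.le_jacobson.trans, fun hIM => ?_⟩
  exact (Ideal.jacobson_mono hIM).trans (jacobson_eq_self_of_isSimpleRing_quotient hM).le

theorem IsLeftPerfect.isSemisimpleRing_quotient_ideal_jacobson {I : Ideal R} [I.IsTwoSided]
    (h : IsLeftPerfect (R ⧸ I)) : IsSemisimpleRing (R ⧸ I.jacobson) := by
  have := h.isSemisimpleRing_quotient_jacobson
  let f : (R ⧸ I) ⧸ Ring.jacobson (R ⧸ I) →+* R ⧸ I.jacobson :=
    Ideal.Quotient.lift _ (Ideal.Quotient.factor I.le_jacobson) fun a ha => by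
      obtain ⟨r, rfl⟩ := Ideal.Quotient.mk_surjective a
      rw [← Ideal.mem_comap, comap_mk_ringJacobson] at ha
      exact Ideal.Quotient.eq_zero_iff_mem.2 ha
  exact f.isSemisimpleRing_of_surjective
    (Ideal.Quotient.lift_surjective_of_surjective _ _ (Ideal.Quotient.factor_surjective _))

theorem IsLeftPerfect.jacobson_eq_sup {I J : Ideal R} [I.IsTwoSided] [J.IsTwoSided]
    (h : IsLeftPerfect (R ⧸ I)) (hIJ : I ≤ J) : J.jacobson = I.jacobson ⊔ J := by
  refine le_antisymm ?_ (sup_le (Ideal.jacobson_mono hIJ) J.le_jacobson)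
  have := h.isSemisimpleRing_quotient_ideal_jacobson
  have hle : I.jacobson ≤ I.jacobson ⊔ J := le_sup_left
  have := (Ideal.Quotient.factor hle).isSemisimpleRing_of_surjective
    (Ideal.Quotient.factor_surjective hle)
  calc J.jacobson ≤ (I.jacobson ⊔ J).jacobson := Ideal.jacobson_mono le_sup_right
    _ = I.jacobson ⊔ J := by
      rw [← comap_mk_ringJacobson, IsSemisimpleRing.jacobson_eq_bot, ← RingHom.ker_eq_comap_bot,
        Ideal.mk_ker]

theorem IsLeftPerfect.isArtinianRing_of_isSimpleRing [IsSimpleRing R] (h : IsLeftPerfect R) :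
    IsArtinianRing R := by
  have hss := h.isSemisimpleRing_quotient_jacobson
  have : Nontrivial (R ⧸ Ring.jacobson R) :=
    Ideal.Quotient.nontrivial_iff.2 (Ring.jacobson_lt_top R).ne
  let e : R ≃+* R ⧸ Ring.jacobson R :=
    .ofBijective _ ⟨(Ideal.Quotient.mk _).injective, Ideal.Quotient.mk_surjective⟩
  exact IsSimpleRing.isSemisimpleRing_iff_isArtinianRing.1 (e.symm.isSemisimpleRing)

end TwoSidedIdeals

section OpenQuotientMaps

/-- The map `f` has a set-theoretic section that tends to zero at zero, so that every family in the
codomain converging to zero lifts to such a family in the domain. -/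
def HasSectionContinuousAtZero {A B : Type*} [Zero A] [TopologicalSpace A] [Zero B]
    [TopologicalSpace B] (f : A → B) : Prop :=
  ∃ s : B → A, Function.RightInverse s f ∧ Tendsto s (𝓝 0) (𝓝 0)

namespace HasSectionContinuousAtZero

variable {A B C : Type*} [Zero A] [TopologicalSpace A] [Zero B] [TopologicalSpace B]
  [Zero C] [TopologicalSpace C] {f : A → B} {g : B → C}

theorem of_isHomeomorph (hf : IsHomeomorph f) (h0 : f 0 = 0) : HasSectionContinuousAtZero f := by
  obtain ⟨e, rfl⟩ := isHomeomorph_iff_exists_homeomorph.1 hf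
  refine ⟨e.symm, e.apply_symm_apply, ?_⟩
  simpa only [← e.symm_apply_eq.2 h0.symm] using e.symm.continuous.tendsto 0

theorem of_discreteTopology [DiscreteTopology B] (hf : Function.Surjective f) (h0 : f 0 = 0) :
    HasSectionContinuousAtZero f := by
  classical
  refine ⟨Function.update (Function.surjInv hf) 0 0, fun b => ?_, ?_⟩
  · rcases eq_or_ne b 0 with rfl | hb
    · rw [Function.update_self, h0]
    · rw [Function.update_of_ne hb, Function.surjInv_eq hf]
  · rw [nhds_discrete, tendsto_pure_left]
    exact fun U hU => by simpa using mem_of_mem_nhds hU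

theorem comp (hg : HasSectionContinuousAtZero g) (hf : HasSectionContinuousAtZero f) :
    HasSectionContinuousAtZero (g ∘ f) :=
  let ⟨s, hs, hs0⟩ := hf
  let ⟨t, ht, ht0⟩ := hg
  ⟨s ∘ t, ht.comp hs, hs0.comp ht0⟩

theorem piMap {ι : Type*} {A B : ι → Type*} [∀ i, Zero (A i)] [∀ i, TopologicalSpace (A i)]
    [∀ i, Zero (B i)] [∀ i, TopologicalSpace (B i)] {f : ∀ i, A i → B i}
    (hf : ∀ i, HasSectionContinuousAtZero (f i)) : HasSectionContinuousAtZero (Pi.map f) := by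
  choose s hs hs0 using hf
  exact ⟨Pi.map s, fun b => funext fun i => hs i (b i),
    tendsto_pi_nhds.2 fun i => (hs0 i).comp ((continuous_apply i).tendsto 0)⟩

/-- A point `b ≠ 0` is lifted into the smallest possible member of a countable base at zero. -/
theorem of_isOpenQuotientMap [(𝓝 (0 : A)).IsCountablyGenerated] [T1Space B]
    (hf : IsOpenQuotientMap f) (h0 : f 0 = 0) : HasSectionContinuousAtZero f := by
  classical
  obtain ⟨U, hU⟩ := (𝓝 (0 : A)).exists_antitone_basis
  have hlift (b : B) : ∃ a, f a = b ∧ ∀ n, b ∈ f '' U n → a ∈ U n := by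
    rcases eq_or_ne b 0 with rfl | hb
    · exact ⟨0, h0, fun n _ => mem_of_mem_nhds (hU.mem n)⟩
    have hex : ∃ n, b ∉ f '' U n := by
      have hne : f ⁻¹' {b}ᶜ ∈ 𝓝 0 :=
        hf.continuous.continuousAt (isOpen_compl_singleton.mem_nhds (h0 ▸ hb.symm))
      obtain ⟨n, hn⟩ := hU.mem_iff.1 hne
      exact ⟨n, fun ⟨a, ha, hab⟩ => hn ha hab⟩
    have hlt {n : ℕ} (hn : b ∈ f '' U n) : n < Nat.find hex := by
      by_contra! hle
      exact Nat.find_spec hex (Set.image_mono (hU.antitone hle) hn)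
    rcases hfind : Nat.find hex with _ | k
    · obtain ⟨a, ha⟩ := hf.surjective b
      exact ⟨a, ha, fun n hn => absurd ((hlt hn).trans_eq hfind) n.not_lt_zero⟩
    · obtain ⟨a, ha, hab⟩ : b ∈ f '' U k := not_not.1 (Nat.find_min hex (by lia))
      exact ⟨a, hab, fun n hn => hU.antitone (Nat.le_of_lt_succ ((hlt hn).trans_eq hfind)) ha⟩
  choose s hs hsU using hlift
  refine ⟨s, hs, hU.tendsto_right_iff.2 fun n _ => ?_⟩
  filter_upwards [h0 ▸ hf.isOpenMap.image_mem_nhds (hU.mem n)] with b hb using hsU b n hb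

end HasSectionContinuousAtZero

theorem isHomeomorph_of_comp_isOpenQuotientMap {X Y Z : Type*} [TopologicalSpace X]
    [TopologicalSpace Y] [TopologicalSpace Z] {p : X → Y} {e : Y → Z} (hp : IsOpenQuotientMap p)
    (he : Function.Bijective e) (hep : IsOpenQuotientMap (e ∘ p)) : IsHomeomorph e :=
  ⟨(hp.of_comp_iff.1 hep).continuous, (hp.of_comp_iff.1 hep).isOpenMap, he⟩

theorem isStronglyClosed_ker {A : Type u} {B : Type*} [AddCommGroup A] [TopologicalSpace A]
    [IsTopologicalAddGroup A] [AddCommGroup B] [UniformSpace B] [IsUniformAddGroup B]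
    [CompleteSpace B] [T1Space B] {f : A →+ B} (hf : IsOpenQuotientMap f)
    (hs : HasSectionContinuousAtZero f) : IsStronglyClosed.{w} f.ker := by
  let e : A ⧸ f.ker ≃+ B := QuotientAddGroup.quotientKerEquivOfSurjective f hf.surjective
  have he : IsHomeomorph e :=
    isHomeomorph_of_comp_isOpenQuotientMap QuotientAddGroup.isOpenQuotientMap_mk e.bijective hf
  refine ⟨isClosed_singleton.preimage hf.continuous, ?_, fun X q hq => ?_⟩
  · let := IsTopologicalAddGroup.rightUniformSpace (A ⧸ f.ker)
    have : IsUniformAddGroup (A ⧸ f.ker) := isUniformAddGroup_of_addCommGroup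
    exact ((AddMonoidHom.isUniformInducing_of_isInducing he.isInducing).completeSpace_congr
      e.surjective).2 inferInstance
  · obtain ⟨s, hsf, hs0⟩ := hs
    have heq : Tendsto (e ∘ q) cofinite (𝓝 0) :=
      (map_zero e ▸ he.continuous.tendsto 0).comp hq
    exact ⟨fun x => s (e (q x)), hs0.comp heq, fun x => e.injective (hsf (e (q x)))⟩

theorem exists_ringEquiv_quotient_isHomeomorph {R S : Type*} [Ring R] [TopologicalSpace R]
    [IsTopologicalRing R] [Ring S] [TopologicalSpace S] {f : R →+* S} (hf : IsOpenQuotientMap f)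
    {H : Ideal R} [H.IsTwoSided] (hker : RingHom.ker f = H) :
    ∃ e : R ⧸ H ≃+* S, IsHomeomorph e ∧ ∀ r, e (Ideal.Quotient.mk H r) = f r := by
  subst hker
  let e := RingHom.quotientKerEquivOfSurjective hf.surjective
  have he : IsHomeomorph e := isHomeomorph_of_comp_isOpenQuotientMap
    (Submodule.isOpenQuotientMap_mkQ _) e.bijective hf
  exact ⟨e, he, fun _ => rfl⟩

theorem isClosed_range_of_isInducing {A B : Type*} [AddCommGroup A] [UniformSpace A]
    [IsUniformAddGroup A] [CompleteSpace A] [AddCommGroup B] [TopologicalSpace B]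
    [IsTopologicalAddGroup B] [T2Space B] {f : A →+ B} (hf : IsInducing f) :
    IsClosed (Set.range f) := by
  let := IsTopologicalAddGroup.rightUniformSpace B
  have : IsUniformAddGroup B := isUniformAddGroup_of_addCommGroup
  exact (AddMonoidHom.isUniformInducing_of_isInducing hf).isComplete_range.isClosed

end OpenQuotientMaps

section OpenIdeals

variable {R : Type u} [Ring R] [TopologicalSpace R]

theorem OpenIdeal.hasBasis_nhds_zero
    (hbase : ∀ U ∈ 𝓝 (0 : R), ∃ I : OpenIdeal R, (I.1 : Set R) ⊆ U) :
    (𝓝 (0 : R)).HasBasis (fun _ : OpenIdeal R => True) fun I => (I.1 : Set R) :=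
  ⟨fun U => ⟨fun hU => (hbase U hU).imp fun _ h => ⟨trivial, h⟩, fun ⟨I, _, h⟩ =>
    mem_of_superset (I.2.2.mem_nhds I.1.zero_mem) h⟩⟩

instance OpenIdeal.discreteTopology [IsTopologicalRing R] (I : OpenIdeal R) :
    DiscreteTopology (R ⧸ I.1) :=
  QuotientAddGroup.discreteTopology I.2.2

theorem OpenIdeal.isOpen_of_le [IsTopologicalRing R] (I : OpenIdeal R) {J : Ideal R}
    (h : I.1 ≤ J) : IsOpen (J : Set R) :=
  AddSubgroup.isOpen_mono (H₁ := I.1.toAddSubgroup) (H₂ := J.toAddSubgroup) h I.2.2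

theorem limJacobson_eq_iInf_jacobson : limJacobson R = ⨅ I : OpenIdeal R, I.1.jacobson :=
  iInf_congr fun I => comap_mk_ringJacobson I.1

theorem isTopologicallyLeftTNilpotent_limJacobson
    (hbase : (𝓝 (0 : R)).HasBasis (fun _ : OpenIdeal R => True) fun I => (I.1 : Set R))
    (hperf : ∀ I : OpenIdeal R, IsLeftPerfect (R ⧸ I.1)) :
    IsTopologicallyLeftTNilpotent (limJacobson R) := by
  intro a ha
  refine hbase.tendsto_right_iff.2 fun I _ => ?_
  have hjac (n) : Ideal.Quotient.mk I.1 (a n) ∈ Ring.jacobson (R ⧸ I.1) :=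
    (Submodule.mem_iInf _).1 (ha n) I
  obtain ⟨N, hN⟩ := (hperf I).exists_prod_eq_zero hjac
  have hNI : ((List.range N).map a).prod ∈ I.1 := by
    rwa [← Ideal.Quotient.eq_zero_iff_mem, map_list_prod, List.map_map]
  filter_upwards [Ici_mem_atTop N] with n (hn : N ≤ n)
  obtain ⟨k, hk⟩ : ∃ k, n + 1 = N + k := Nat.exists_eq_add_of_le (Nat.le_succ_of_le hn)
  rw [SetLike.mem_coe, hk, List.range_add, List.map_append, List.prod_append]
  exact I.1.mul_mem_right _ hNI

/-- The open two-sided ideals `G` such that `R ⧸ G` is a simple ring. -/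
abbrev OpenSimpleIdeal (R : Type u) [Ring R] [TopologicalSpace R] : Type u :=
  {G : OpenIdeal R // IsSimpleRing (R ⧸ G.1)}

theorem mem_jacobson_iff_forall_openSimpleIdeal [IsTopologicalRing R] {I : OpenIdeal R}
    (h : IsLeftPerfect (R ⧸ I.1)) {x : R} :
    x ∈ I.1.jacobson ↔ ∀ G : OpenSimpleIdeal R, I.1 ≤ G.1.1 → x ∈ G.1.1 := by
  have := h.isSemisimpleRing_quotient_ideal_jacobson
  rw [← sInf_simpleQuotientIdeals I.1.jacobson, simpleQuotientIdeals_jacobson, Submodule.mem_sInf]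
  exact ⟨fun hx G hIG => hx G.1.1 ⟨hIG, inferInstance, G.2⟩, fun hx G ⟨hIG, hG, hGs⟩ =>
    hx ⟨⟨G, hG, I.isOpen_of_le hIG⟩, hGs⟩ hIG⟩

theorem limJacobson_eq_iInf_openSimpleIdeal [IsTopologicalRing R]
    (hperf : ∀ I : OpenIdeal R, IsLeftPerfect (R ⧸ I.1)) :
    limJacobson R = ⨅ G : OpenSimpleIdeal R, G.1.1 := by
  ext x
  simp only [limJacobson_eq_iInf_jacobson, Submodule.mem_iInf,
    mem_jacobson_iff_forall_openSimpleIdeal (hperf _)]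
  exact ⟨fun hx G => hx G.1 G le_rfl, fun hx _ G _ => hx G⟩

theorem finite_setOf_le_openSimpleIdeal {I : OpenIdeal R} (h : IsLeftPerfect (R ⧸ I.1)) :
    {G : OpenSimpleIdeal R | I.1 ≤ G.1.1}.Finite := by
  have := h.isSemisimpleRing_quotient_ideal_jacobson
  have hfin : (simpleQuotientIdeals I.1).Finite :=
    simpleQuotientIdeals_jacobson I.1 ▸ finite_simpleQuotientIdeals I.1.jacobson
  refine (hfin.preimage (f := fun G : OpenSimpleIdeal R => G.1.1) ?_).subset fun G hG =>
    ⟨hG, inferInstance, G.2⟩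
  exact fun _ _ _ _ hGG => Subtype.ext (Subtype.ext hGG)

theorem exists_forall_mk_eq_of_finite {s : Set (OpenSimpleIdeal R)} (hs : s.Finite)
    (x : ∀ G : OpenSimpleIdeal R, R ⧸ G.1.1) : ∃ r, ∀ G ∈ s, Ideal.Quotient.mk G.1.1 r = x G := by
  have := hs.to_subtype
  choose y hy using fun G => Ideal.Quotient.mk_surjective (x G)
  have hcop : Pairwise fun G G' : s => G.1.1.1 ⊔ G'.1.1.1 = ⊤ := fun G G' hne =>
    sup_eq_top_of_isSimpleRing_quotient G.1.2 G'.1.2 fun h =>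
      hne (Subtype.ext (Subtype.ext (Subtype.ext h)))
  obtain ⟨r, hr⟩ := exists_forall_sub_mem_of_pairwise_sup_eq_top hcop fun G => y G
  exact ⟨r, fun G hG => (Ideal.Quotient.mk_eq_mk_iff_sub_mem _ _).2 (hr ⟨G, hG⟩) |>.trans (hy G)⟩

theorem exists_mem_forall_mk_eq [IsTopologicalRing R]
    (hperf : ∀ I : OpenIdeal R, IsLeftPerfect (R ⧸ I.1)) {I K : OpenIdeal R} (hKI : K.1 ≤ I.1)
    {x : ∀ G : OpenSimpleIdeal R, R ⧸ G.1.1} (hx : ∀ G : OpenSimpleIdeal R, I.1 ≤ G.1.1 → x G = 0) :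
    ∃ r ∈ I.1, ∀ G : OpenSimpleIdeal R, K.1 ≤ G.1.1 → Ideal.Quotient.mk G.1.1 r = x G := by
  obtain ⟨y, hy⟩ := exists_forall_mk_eq_of_finite (finite_setOf_le_openSimpleIdeal (hperf K)) x
  have hyI : y ∈ I.1.jacobson := by
    refine (mem_jacobson_iff_forall_openSimpleIdeal (hperf I)).2 fun G hG => ?_
    rw [← Ideal.Quotient.eq_zero_iff_mem, hy G (hKI.trans hG), hx G hG]
  rw [(hperf K).jacobson_eq_sup hKI] at hyI
  obtain ⟨j, hj, r, hr, rfl⟩ := Submodule.mem_sup.1 hyI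
  refine ⟨r, hr, fun G hG => ?_⟩
  have hjG : j ∈ G.1.1 := (mem_jacobson_iff_forall_openSimpleIdeal (hperf K)).1 hj G hG
  rw [← hy G hG, map_add, Ideal.Quotient.eq_zero_iff_mem.2 hjG, zero_add]

/-- The natural ring homomorphism from `R` to the product of its quotients by a family of open
two-sided ideals. -/
def toQuotients {ι : Type*} (M : ι → OpenIdeal R) : R →+* ∀ i, R ⧸ (M i).1 :=
  RingHom.pi fun i => Ideal.Quotient.mk (M i).1

theorem continuous_toQuotients {ι : Type*} (M : ι → OpenIdeal R) : Continuous (toQuotients M) :=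
  continuous_pi fun _ => continuous_quot_mk

theorem ker_toQuotients {ι : Type*} (M : ι → OpenIdeal R) :
    RingHom.ker (toQuotients M) = ⨅ i, (M i).1 := by
  ext x
  rw [RingHom.mem_ker, funext_iff, Submodule.mem_iInf]
  exact forall_congr' fun _ => Ideal.Quotient.eq_zero_iff_mem

/-- The family `M` exhibits `R ⧸ limJacobson R` as a topological product of simple rings in such a
way that families converging to zero can be lifted along the projection from `R`. -/
structure IsRadicalDecomposition {ι : Type*} (M : ι → OpenIdeal R) : Prop where
  isSimpleRing (i : ι) : IsSimpleRing (R ⧸ (M i).1)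
  iInf_eq : ⨅ i, (M i).1 = limJacobson R
  isOpenQuotientMap : IsOpenQuotientMap (toQuotients M)
  hasSection : HasSectionContinuousAtZero (toQuotients M)

namespace IsRadicalDecomposition

variable {ι : Type*} {M : ι → OpenIdeal R}

theorem exists_ringEquiv [IsTopologicalRing R] (hM : IsRadicalDecomposition M) :
    ∃ e : (R ⧸ limJacobson R) ≃+* ∀ i, R ⧸ (M i).1,
      IsHomeomorph e ∧ ∀ r, e (Ideal.Quotient.mk _ r) = toQuotients M r :=
  exists_ringEquiv_quotient_isHomeomorph hM.isOpenQuotientMap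
    ((ker_toQuotients M).trans hM.iInf_eq)

theorem isStronglyClosed [IsTopologicalRing R] (hM : IsRadicalDecomposition M) :
    IsStronglyClosed.{w} (limJacobson R).toAddSubgroup := by
  let (i : ι) : UniformSpace (R ⧸ (M i).1) := IsTopologicalAddGroup.rightUniformSpace _
  have (i : ι) : IsUniformAddGroup (R ⧸ (M i).1) := isUniformAddGroup_of_addCommGroup
  have (i : ι) : CompleteSpace (R ⧸ (M i).1) :=
    IsRightUniformAddGroup.completeSpace_of_weaklyLocallyCompactSpace
  rw [← hM.iInf_eq, ← ker_toQuotients]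
  exact isStronglyClosed_ker (f := (toQuotients M).toAddMonoidHom) hM.isOpenQuotientMap
    hM.hasSection

end IsRadicalDecomposition

theorem isRadicalDecomposition_of_finite [IsTopologicalRing R] [Finite (OpenSimpleIdeal R)]
    (hperf : ∀ I : OpenIdeal R, IsLeftPerfect (R ⧸ I.1)) :
    IsRadicalDecomposition fun G : OpenSimpleIdeal R => G.1 := by
  have hsurj : Function.Surjective (toQuotients fun G : OpenSimpleIdeal R => G.1) := fun x =>
    (exists_forall_mk_eq_of_finite Set.finite_univ x).imp fun _ hr => funext fun G => hr G trivial
  exact ⟨fun G => G.2, (limJacobson_eq_iInf_openSimpleIdeal hperf).symm,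
    ⟨hsurj, continuous_toQuotients _, fun _ _ => isOpen_discrete _⟩,
    .of_discreteTopology hsurj (map_zero _)⟩

theorem finite_openSimpleIdeal (hperf : ∀ I : OpenIdeal R, IsLeftPerfect (R ⧸ I.1))
    (hfin : {I : OpenIdeal R | IsSemisimpleRing (R ⧸ I.1)}.Finite) :
    Finite (OpenSimpleIdeal R) :=
  (hfin.subset fun G (_ : IsSimpleRing (R ⧸ G.1)) =>
    IsSimpleRing.isSemisimpleRing_iff_isArtinianRing.2
      (hperf G).isArtinianRing_of_isSimpleRing).to_subtype

end OpenIdeals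

theorem exists_limit_of_successive_approximations {A : Type*} [AddCommGroup A] [UniformSpace A]
    [IsUniformAddGroup A] [CompleteSpace A] {K : ℕ → OpenAddSubgroup A}
    (hK : (𝓝 (0 : A)).HasAntitoneBasis fun n => (K n : Set A)) {P : ℕ → A → Prop} {a₀ : A}
    (hzero : P 0 a₀) (hstep : ∀ n a, P n a → ∃ a', a' - a ∈ K n ∧ P (n + 1) a') :
    ∃ s, ∀ n, ∃ a, P n a ∧ s - a ∈ K n := by
  have : NonarchimedeanAddGroup A := ⟨fun U hU => (hK.mem_iff.1 hU).imp' K fun _ h => h⟩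
  choose next hnextK hnext using hstep
  let a : (n : ℕ) → {a // P n a} :=
    Nat.rec ⟨a₀, hzero⟩ fun n a => ⟨next n a a.2, hnext n a a.2⟩
  have hdiff (n : ℕ) : (a (n + 1)).1 - (a n).1 ∈ K n := hnextK n (a n).1 (a n).2
  have hcauchy : CauchySeq fun n => (a n).1 :=
    NonarchimedeanAddGroup.cauchySeq_of_tendsto_sub_nhds_zero (hK.tendsto hdiff)
  have hsub (m n : ℕ) (hmn : m ≤ n) : (a n).1 - (a m).1 ∈ K m := by
    induction n, hmn using Nat.le_induction with
    | base => simpa only [sub_self] using zero_mem (K m)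
    | succ n hmn ih =>
      simpa only [sub_add_sub_cancel] using add_mem (hK.antitone hmn (hdiff n)) ih
  obtain ⟨s, hs⟩ := cauchySeq_tendsto_of_complete hcauchy
  exact ⟨s, fun n => ⟨(a n).1, (a n).2,
    (K n).isClosed.mem_of_tendsto (hs.sub_const _) (eventually_atTop.2 ⟨n, hsub n⟩)⟩⟩

section CountableBase

variable {R : Type u} [Ring R]

theorem exists_mem_toQuotients_eq [UniformSpace R] [IsUniformAddGroup R] [IsTopologicalRing R]
    [CompleteSpace R] (hperf : ∀ I : OpenIdeal R, IsLeftPerfect (R ⧸ I.1)) {K : ℕ → OpenIdeal R}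
    (hK : (𝓝 (0 : R)).HasAntitoneBasis fun n => ((K n).1 : Set R))
    {x : ∀ G : OpenSimpleIdeal R, R ⧸ G.1.1}
    (hx : ∀ G : OpenSimpleIdeal R, (K 0).1 ≤ G.1.1 → x G = 0) :
    ∃ r ∈ (K 0).1, toQuotients (fun G : OpenSimpleIdeal R => G.1) r = x := by
  let Solves (n : ℕ) (r : R) : Prop := r ∈ (K 0).1 ∧
    ∀ G : OpenSimpleIdeal R, (K n).1 ≤ G.1.1 → Ideal.Quotient.mk G.1.1 r = x G
  have hzero : Solves 0 0 := ⟨zero_mem _, fun G hG => (map_zero _).trans (hx G hG).symm⟩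
  have hstep (n : ℕ) (r : R) (hr : Solves n r) : ∃ r', r' - r ∈ (K n).1 ∧ Solves (n + 1) r' := by
    obtain ⟨d, hdK, hd⟩ := exists_mem_forall_mk_eq hperf (hK.antitone n.le_succ)
      (x := fun G => x G - Ideal.Quotient.mk G.1.1 r) fun G hG => sub_eq_zero.2 (hr.2 G hG).symm
    refine ⟨r + d, by rwa [add_sub_cancel_left],
      add_mem hr.1 (hK.antitone n.zero_le hdK), fun G hG => ?_⟩
    rw [map_add, hd G hG, add_sub_cancel]
  obtain ⟨s, hs⟩ := exists_limit_of_successive_approximations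
    (K := fun n => (⟨(K n).1.toAddSubgroup, (K n).2.2⟩ : OpenAddSubgroup R)) hK hzero hstep
  refine ⟨s, ?_, funext fun G => ?_⟩
  · obtain ⟨r, hr, hsr⟩ := hs 0
    exact (Submodule.sub_mem_iff_left _ hr.1).1 hsr
  · obtain ⟨n, hn⟩ := hK.mem_iff.1 (G.1.2.2.mem_nhds G.1.1.zero_mem)
    obtain ⟨r, hr, hsr⟩ := hs n
    exact ((Ideal.Quotient.mk_eq_mk_iff_sub_mem _ _).2 (hn hsr)).trans (hr.2 G hn)

theorem isRadicalDecomposition_of_isCountablyGenerated [UniformSpace R] [IsUniformAddGroup R]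
    [IsTopologicalRing R] [CompleteSpace R] [(𝓝 (0 : R)).IsCountablyGenerated]
    (hbase : (𝓝 (0 : R)).HasBasis (fun _ : OpenIdeal R => True) fun I => (I.1 : Set R))
    (hperf : ∀ I : OpenIdeal R, IsLeftPerfect (R ⧸ I.1)) :
    IsRadicalDecomposition fun G : OpenSimpleIdeal R => G.1 := by
  obtain ⟨K, -, hK⟩ := hbase.exists_antitone_subbasis
  let f := toQuotients fun G : OpenSimpleIdeal R => G.1
  have hsurj : Function.Surjective f := fun x => by
    obtain ⟨y, hy⟩ :=
      exists_forall_mk_eq_of_finite (finite_setOf_le_openSimpleIdeal (hperf (K 0))) x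
    obtain ⟨r, -, hr⟩ := exists_mem_toQuotients_eq hperf hK (x := x - f y) fun G hG =>
      sub_eq_zero.2 (hy G hG).symm
    exact ⟨y + r, by rw [map_add, hr, add_sub_cancel]⟩
  have hopen : IsOpenMap f := by
    refine IsTopologicalAddGroup.isOpenMap_iff_nhds_zero.2 ((hK.map f).ge_iff.2 fun n _ => ?_)
    have hnhds : {G : OpenSimpleIdeal R | (K n).1 ≤ G.1.1}.pi (fun G => {(0 : R ⧸ G.1.1)}) ∈ 𝓝 0 :=
      set_pi_mem_nhds (finite_setOf_le_openSimpleIdeal (hperf (K n))) fun G _ =>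
        (isOpen_discrete _).mem_nhds rfl
    refine mem_of_superset hnhds fun x hx => ?_
    exact exists_mem_toQuotients_eq hperf
      (hK.comp_strictMono (strictMono_id.const_add n)) hx
  have hquot : IsOpenQuotientMap f := ⟨hsurj, continuous_toQuotients _, hopen⟩
  exact ⟨fun G => G.2, (limJacobson_eq_iInf_openSimpleIdeal hperf).symm, hquot,
    .of_isOpenQuotientMap hquot (map_zero f)⟩

end CountableBase

section Saturation

theorem IsLeftPerfect.exists_pow_mul_one_sub_mul_eq_zero {S : Type u} [CommRing S]
    (h : IsLeftPerfect S) (s : S) : ∃ n t, s ^ n * (1 - s * t) = 0 := by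
  obtain ⟨t, ht⟩ := h.exists_sub_mul_mul_mem_jacobson s
  obtain ⟨n, hn⟩ := h.exists_prod_eq_zero fun _ => ht
  rw [List.map_const', List.prod_replicate, List.length_range] at hn
  obtain ⟨c, hc⟩ := sub_dvd_pow_sub_pow 1 (1 - s * t) n
  refine ⟨n, t * c, ?_⟩
  rw [← mul_assoc s, ← sub_sub_cancel 1 (s * t), ← hc, one_pow, sub_sub_cancel, ← mul_pow, ← hn]
  ring

variable {R : Type u} [CommRing R]

/-- The contraction to `R` of the extension of `I` to the localization of `R` at the prime `P`. If
`R ⧸ I` is perfect and `P ⊇ I` is maximal, then `R ⧸ saturationAt I P` is the local factor of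
`R ⧸ I` at `P`. -/
def saturationAt (I P : Ideal R) [P.IsPrime] : Ideal R :=
  (I.map (algebraMap R (Localization.AtPrime P))).comap (algebraMap R (Localization.AtPrime P))

theorem mem_saturationAt {I P : Ideal R} [P.IsPrime] {r : R} :
    r ∈ saturationAt I P ↔ ∃ s ∉ P, s * r ∈ I := by
  rw [saturationAt, Ideal.mem_comap,
    IsLocalization.algebraMap_mem_map_algebraMap_iff P.primeCompl]
  rfl

theorem le_saturationAt (I P : Ideal R) [P.IsPrime] : I ≤ saturationAt I P :=
  Ideal.le_comap_map

theorem saturationAt_mono {I J : Ideal R} (h : I ≤ J) (P : Ideal R) [P.IsPrime] :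
    saturationAt I P ≤ saturationAt J P :=
  Ideal.comap_mono (Ideal.map_mono h)

theorem saturationAt_le {I P : Ideal R} [hP : P.IsPrime] (h : I ≤ P) : saturationAt I P ≤ P :=
  fun _ hr =>
    let ⟨_, hs, hsr⟩ := mem_saturationAt.1 hr
    (hP.mem_or_mem (h hsr)).resolve_left hs

theorem saturationAt_eq_top {I P : Ideal R} [P.IsPrime] (h : ¬I ≤ P) : saturationAt I P = ⊤ := by
  obtain ⟨s, hsI, hsP⟩ := SetLike.not_le_iff_exists.1 h
  exact (Ideal.eq_top_iff_one _).2 (mem_saturationAt.2 ⟨s, hsP, by rwa [mul_one]⟩)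

theorem mem_of_forall_mem_saturationAt {I : Ideal R} {r : R}
    (h : ∀ (P : Ideal R) [P.IsMaximal], I ≤ P → r ∈ saturationAt I P) : r ∈ I := by
  refine Ideal.mem_of_localization_maximal fun P _ => ?_
  rw [← Ideal.mem_comap]
  by_cases hIP : I ≤ P
  · exact h P hIP
  · exact (saturationAt_eq_top hIP).ge trivial

theorem saturationAt_le_self {J P : Ideal R} [P.IsMaximal] [IsLocalRing (R ⧸ J)] (h : J ≤ P) :
    saturationAt J P ≤ J := by
  let := Ideal.Quotient.field P
  have hloc : IsLocalHom (Ideal.Quotient.factor h) :=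
    .of_surjective _ (Ideal.Quotient.factor_surjective h)
  intro r hr
  obtain ⟨s, hs, hsr⟩ := mem_saturationAt.1 hr
  have hunit : IsUnit (Ideal.Quotient.mk J s) := hloc.map_nonunit _ <|
    (Ideal.Quotient.factor_mk h s).symm ▸ Ne.isUnit (mt Ideal.Quotient.eq_zero_iff_mem.1 hs)
  rw [← Ideal.Quotient.eq_zero_iff_mem, map_mul] at hsr
  exact Ideal.Quotient.eq_zero_iff_mem.1 (hunit.mul_right_eq_zero.1 hsr)

namespace IsLeftPerfect

variable {I : Ideal R}

theorem isUnit_mk_saturationAt (h : IsLeftPerfect (R ⧸ I)) {P : Ideal R} [hP : P.IsPrime] {s : R}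
    (hs : s ∉ P) : IsUnit (Ideal.Quotient.mk (saturationAt I P) s) := by
  obtain ⟨n, t, ht⟩ := h.exists_pow_mul_one_sub_mul_eq_zero (Ideal.Quotient.mk I s)
  obtain ⟨t, rfl⟩ := Ideal.Quotient.mk_surjective t
  have hmem : 1 - s * t ∈ saturationAt I P :=
    mem_saturationAt.2 ⟨s ^ n, fun hsn => hs (hP.mem_of_pow_mem n hsn),
      Ideal.Quotient.eq_zero_iff_mem.1 ht⟩
  refine .of_mul_eq_one (Ideal.Quotient.mk _ t) ?_
  rw [← map_mul, ← map_one (Ideal.Quotient.mk _), eq_comm]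
  exact (Ideal.Quotient.mk_eq_mk_iff_sub_mem _ _).2 hmem

theorem isLocalRing_quotient_saturationAt (h : IsLeftPerfect (R ⧸ I)) {P : Ideal R}
    [P.IsMaximal] (hIP : I ≤ P) : IsLocalRing (R ⧸ saturationAt I P) := by
  let := Ideal.Quotient.field P
  have : IsLocalHom (Ideal.Quotient.factor (saturationAt_le hIP)) := by
    refine ⟨fun a ha => ?_⟩
    obtain ⟨s, rfl⟩ := Ideal.Quotient.mk_surjective a
    rw [Ideal.Quotient.factor_mk] at ha
    exact h.isUnit_mk_saturationAt (mt Ideal.Quotient.eq_zero_iff_mem.2 ha.ne_zero)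
  exact RingHom.domain_isLocalRing (Ideal.Quotient.factor (saturationAt_le hIP))

theorem eq_of_saturationAt_le (h : IsLeftPerfect (R ⧸ I)) {P M : Ideal R} [P.IsPrime]
    [hM : M.IsMaximal] (hle : saturationAt I P ≤ M) : M = P := by
  refine hM.eq_of_le Ideal.IsPrime.ne_top' fun s hs => ?_
  by_contra hsP
  have hunit := (h.isUnit_mk_saturationAt hsP).map (Ideal.Quotient.factor hle)
  rw [Ideal.Quotient.factor_mk, Ideal.Quotient.eq_zero_iff_mem.2 hs] at hunit
  exact not_isUnit_zero hunit

theorem saturationAt_sup_saturationAt (h : IsLeftPerfect (R ⧸ I)) {P Q : Ideal R} [P.IsPrime]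
    [Q.IsPrime] (hne : P ≠ Q) : saturationAt I P ⊔ saturationAt I Q = ⊤ := by
  by_contra htop
  obtain ⟨M, hM, hle⟩ := Ideal.exists_le_maximal _ htop
  exact hne ((h.eq_of_saturationAt_le (le_sup_left.trans hle)).symm.trans
    (h.eq_of_saturationAt_le (le_sup_right.trans hle)))

end IsLeftPerfect

end Saturation

section LocalPieces

variable {R : Type u} [CommRing R] [TopologicalSpace R]

instance OpenFieldIdeal.isMaximal (G : OpenFieldIdeal R) : G.1.1.IsMaximal :=
  Ideal.Quotient.maximal_of_isField _ G.2

/-- In a commutative ring, the open ideals with simple quotient are those whose quotient is a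
field. -/
def openFieldIdealEquiv : OpenFieldIdeal R ≃ OpenSimpleIdeal R :=
  Equiv.subtypeEquivRight fun _ => (isSimpleRing_iff_isField _).symm

theorem limJacobson_eq_iInf_openFieldIdeal [IsTopologicalRing R]
    (hperf : ∀ I : OpenIdeal R, IsLeftPerfect (R ⧸ I.1)) :
    limJacobson R = ⨅ G : OpenFieldIdeal R, G.1.1 :=
  (limJacobson_eq_iInf_openSimpleIdeal hperf).trans
    (openFieldIdealEquiv.iInf_congr fun _ => rfl).symm

theorem finite_setOf_le_openFieldIdeal {I : OpenIdeal R} (h : IsLeftPerfect (R ⧸ I.1)) :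
    {G : OpenFieldIdeal R | I.1 ≤ G.1.1}.Finite :=
  (finite_setOf_le_openSimpleIdeal h).preimage openFieldIdealEquiv.injective.injOn

theorem saturationAt_le_of_openLocalIdeal {G : OpenFieldIdeal R} (J : OpenLocalIdeal G)
    {I : Ideal R} (hIJ : I ≤ J.1.1) : saturationAt I G.1.1 ≤ J.1.1 :=
  have := J.2.1
  (saturationAt_mono hIJ _).trans (saturationAt_le_self J.2.2)

/-- The saturation of a smaller open ideal at `G`. -/
def OpenLocalIdeal.ofLE [IsTopologicalRing R] {G : OpenFieldIdeal R} {I : OpenIdeal R}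
    (h : IsLeftPerfect (R ⧸ I.1)) (hIG : I.1 ≤ G.1.1) : OpenLocalIdeal G :=
  ⟨⟨saturationAt I.1 G.1.1, inferInstance, I.isOpen_of_le (le_saturationAt _ _)⟩,
    h.isLocalRing_quotient_saturationAt hIG, saturationAt_le hIG⟩

/-- The natural ring homomorphism `R_G → R ⧸ G`, with kernel `LocalPiece.residueKernel G`. -/
def LocalPiece.residue (G : OpenFieldIdeal R) : LocalPiece G →+* R ⧸ G.1.1 :=
  (Pi.evalRingHom (fun J : OpenLocalIdeal G => R ⧸ J.1.1) (OpenLocalIdeal.self G)).comp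
    (LocalPiece G).subtype

theorem LocalPiece.residue_surjective (G : OpenFieldIdeal R) :
    Function.Surjective (LocalPiece.residue G) :=
  .of_comp (g := toLocalPiece G) Ideal.Quotient.mk_surjective

theorem LocalPiece.continuous_residue (G : OpenFieldIdeal R) :
    Continuous (LocalPiece.residue G) :=
  (continuous_apply _).comp continuous_subtype_val

instance LocalPiece.isLocalHom_residue (G : OpenFieldIdeal R) :
    IsLocalHom (LocalPiece.residue G) := by
  let := Ideal.Quotient.field G.1.1
  refine ⟨fun x hx => ?_⟩
  have hunit (J : OpenLocalIdeal G) : IsUnit (x.1 J) := by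
    have := J.2.1
    have hloc : IsLocalHom (Ideal.Quotient.factor J.2.2) :=
      .of_surjective _ (Ideal.Quotient.factor_surjective J.2.2)
    exact hloc.map_nonunit _ ((x.2 J (OpenLocalIdeal.self G) J.2.2).symm ▸ hx)
  choose y hy using fun J => (hunit J).exists_right_inv
  have hcompat : y ∈ LocalPiece G := fun J J' h => by
    refine left_inv_eq_right_inv (a := x.1 J') ?_ (hy J')
    rw [← x.2 J J' h, ← map_mul, mul_comm, hy, map_one]
  exact .of_mul_eq_one ⟨y, hcompat⟩ (Subtype.ext (funext hy))

theorem LocalPiece.isLocalRing (G : OpenFieldIdeal R) : IsLocalRing (LocalPiece G) :=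
  have := isLocalRing_of_isField_aux G.2
  RingHom.domain_isLocalRing (LocalPiece.residue G)

end LocalPieces

section LocalDecomposition

variable {R : Type u} [CommRing R]

theorem continuous_toLocalPieces [TopologicalSpace R] : Continuous (toLocalPieces R) :=
  continuous_pi fun _ => (continuous_pi fun _ => continuous_quot_mk).subtype_mk _

theorem isInducing_toLocalPieces [TopologicalSpace R] [IsTopologicalRing R]
    (hbase : (𝓝 (0 : R)).HasBasis (fun _ : OpenIdeal R => True) fun I => (I.1 : Set R))
    (hperf : ∀ I : OpenIdeal R, IsLeftPerfect (R ⧸ I.1)) : IsInducing (toLocalPieces R) := by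
  refine IsTopologicalAddGroup.isInducing_iff_nhds_zero.2 (le_antisymm ?_ ?_)
  · exact (map_zero (toLocalPieces R) ▸ continuous_toLocalPieces.tendsto 0).le_comap
  refine hbase.ge_iff.2 fun I _ => ?_
  have hcoord (G : {G : OpenFieldIdeal R | I.1 ≤ G.1.1}) :
      {y : ∀ G : OpenFieldIdeal R, LocalPiece G | (y G.1).1 (.ofLE (hperf I) G.2) = 0} ∈ 𝓝 0 := by
    have hcont : Continuous fun y : ∀ G : OpenFieldIdeal R, LocalPiece G =>
        (y G.1).1 (.ofLE (hperf I) G.2) :=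
      (continuous_apply _).comp (continuous_subtype_val.comp (continuous_apply G.1))
    exact ((isOpen_discrete {0}).preimage hcont).mem_nhds rfl
  have := (finite_setOf_le_openFieldIdeal (hperf I)).to_subtype
  refine mem_comap.2 ⟨_, iInter_mem.2 hcoord, fun r hr => ?_⟩
  refine mem_of_forall_mem_saturationAt fun P hP hIP => ?_
  let G : OpenFieldIdeal R := ⟨⟨P, inferInstance, I.isOpen_of_le hIP⟩,
    (Ideal.Quotient.maximal_ideal_iff_isField_quotient P).1 hP⟩
  exact Ideal.Quotient.eq_zero_iff_mem.1 (Set.mem_iInter.1 hr ⟨G, hIP⟩)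

instance OpenIdeal.isCodirectedOrder [TopologicalSpace R] : IsCodirectedOrder (OpenIdeal R) where
  directed I J := ⟨⟨I.1 ⊓ J.1, inferInstance, I.2.2.inter J.2.2⟩,
    (inf_le_left : I.1 ⊓ J.1 ≤ I.1), (inf_le_right : I.1 ⊓ J.1 ≤ J.1)⟩

instance OpenIdeal.nonempty [TopologicalSpace R] : Nonempty (OpenIdeal R) :=
  ⟨⟨⊤, inferInstance, isOpen_univ⟩⟩

theorem exists_forall_toLocalPiece_eq [TopologicalSpace R] [IsTopologicalRing R] {I : OpenIdeal R}
    (h : IsLeftPerfect (R ⧸ I.1)) (x : ∀ G : OpenFieldIdeal R, LocalPiece G) :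
    ∃ r, ∀ (G : OpenFieldIdeal R) (J : OpenLocalIdeal G), I.1 ≤ J.1.1 →
      (toLocalPiece G r).1 J = (x G).1 J := by
  have := (finite_setOf_le_openFieldIdeal h).to_subtype
  choose y hy using fun G : {G : OpenFieldIdeal R | I.1 ≤ G.1.1} =>
    Ideal.Quotient.mk_surjective ((x G).1 (.ofLE h G.2))
  have hcop : Pairwise fun G G' : {G : OpenFieldIdeal R | I.1 ≤ G.1.1} =>
      saturationAt I.1 G.1.1.1 ⊔ saturationAt I.1 G'.1.1.1 = ⊤ := fun G G' hne =>
    h.saturationAt_sup_saturationAt fun hGG =>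
      hne (Subtype.ext (Subtype.ext (Subtype.ext hGG)))
  obtain ⟨r, hr⟩ := exists_forall_sub_mem_of_pairwise_sup_eq_top hcop y
  refine ⟨r, fun G J hIJ => ?_⟩
  have hIG : I.1 ≤ G.1.1 := hIJ.trans J.2.2
  have hmk : Ideal.Quotient.mk (saturationAt I.1 G.1.1) r = (x G).1 (.ofLE h hIG) :=
    ((Ideal.Quotient.mk_eq_mk_iff_sub_mem _ _).2 (hr ⟨G, hIG⟩)).trans (hy ⟨G, hIG⟩)
  rw [← (x G).2 (.ofLE h hIG) J (saturationAt_le_of_openLocalIdeal J hIJ), ← hmk]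
  rfl

theorem denseRange_toLocalPieces [TopologicalSpace R] [IsTopologicalRing R]
    (hperf : ∀ I : OpenIdeal R, IsLeftPerfect (R ⧸ I.1)) : DenseRange (toLocalPieces R) := by
  intro x
  choose r hr using fun I : OpenIdeal R => exists_forall_toLocalPiece_eq (hperf I) x
  have hlim : Tendsto (fun I => toLocalPieces R (r I)) atBot (𝓝 x) :=
    tendsto_pi_nhds.2 fun G => tendsto_subtype_rng.2 <| tendsto_pi_nhds.2 fun J =>
      EventuallyEq.tendsto ((eventually_le_atBot J.1).mono fun I hI => hr I G J hI)
  exact mem_closure_of_tendsto hlim (Eventually.of_forall fun I => Set.mem_range_self (r I))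

variable [UniformSpace R] [IsUniformAddGroup R] [IsTopologicalRing R] [CompleteSpace R]
  [T2Space R]

theorem isHomeomorph_toLocalPieces
    (hbase : (𝓝 (0 : R)).HasBasis (fun _ : OpenIdeal R => True) fun I => (I.1 : Set R))
    (hperf : ∀ I : OpenIdeal R, IsLeftPerfect (R ⧸ I.1)) : IsHomeomorph (toLocalPieces R) := by
  have hind := isInducing_toLocalPieces hbase hperf
  have hclosed : IsClosed (Set.range (toLocalPieces R)) :=
    isClosed_range_of_isInducing (f := (toLocalPieces R).toAddMonoidHom) hind
  refine isHomeomorph_iff_isEmbedding_surjective.2 ⟨hind.isEmbedding, ?_⟩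
  rw [← Set.range_eq_univ, ← hclosed.closure_eq, (denseRange_toLocalPieces hperf).closure_range]

theorem image_toLocalPieces_limJacobson
    (hbase : (𝓝 (0 : R)).HasBasis (fun _ : OpenIdeal R => True) fun I => (I.1 : Set R))
    (hperf : ∀ I : OpenIdeal R, IsLeftPerfect (R ⧸ I.1)) :
    toLocalPieces R '' (limJacobson R : Set R) =
      Set.univ.pi fun G => (LocalPiece.residueKernel G : Set (LocalPiece G)) := by
  have hpre : (limJacobson R : Set R) = toLocalPieces R ⁻¹'
      Set.univ.pi fun G => (LocalPiece.residueKernel G : Set (LocalPiece G)) := by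
    ext r
    simp only [limJacobson_eq_iInf_openFieldIdeal hperf, SetLike.mem_coe, Submodule.mem_iInf,
      Set.mem_preimage, Set.mem_univ_pi]
    exact forall_congr' fun G => Ideal.Quotient.eq_zero_iff_mem.symm
  rw [hpre, Set.image_preimage_eq _ (isHomeomorph_toLocalPieces hbase hperf).surjective]

theorem isRadicalDecomposition_openFieldIdeal
    (hbase : (𝓝 (0 : R)).HasBasis (fun _ : OpenIdeal R => True) fun I => (I.1 : Set R))
    (hperf : ∀ I : OpenIdeal R, IsLeftPerfect (R ⧸ I.1)) :
    IsRadicalDecomposition fun G : OpenFieldIdeal R => G.1 := by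
  have hiso := isHomeomorph_toLocalPieces hbase hperf
  have hresidue (G : OpenFieldIdeal R) : IsOpenQuotientMap (LocalPiece.residue G) :=
    ⟨LocalPiece.residue_surjective G, LocalPiece.continuous_residue G, fun _ _ => isOpen_discrete _⟩
  exact {
    isSimpleRing := fun G => (isSimpleRing_iff_isField _).2 G.2
    iInf_eq := (limJacobson_eq_iInf_openFieldIdeal hperf).symm
    isOpenQuotientMap :=
      (IsOpenQuotientMap.piMap hresidue).comp ⟨hiso.surjective, hiso.continuous, hiso.isOpenMap⟩
    hasSection :=
      (HasSectionContinuousAtZero.piMap fun G => .of_discreteTopology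
        (LocalPiece.residue_surjective G) (map_zero _)).comp (.of_isHomeomorph hiso (map_zero _)) }

end LocalDecomposition

theorem exists_isRadicalDecomposition {R : Type u} [Ring R] [UniformSpace R] [IsUniformAddGroup R]
    [IsTopologicalRing R] [T2Space R] [CompleteSpace R]
    (hbase : (𝓝 (0 : R)).HasBasis (fun _ : OpenIdeal R => True) fun I => (I.1 : Set R))
    (hperf : ∀ I : OpenIdeal R, IsLeftPerfect (R ⧸ I.1))
    (habc : (∀ x y : R, x * y = y * x) ∨ (𝓝 (0 : R)).IsCountablyGenerated ∨
      {I : OpenIdeal R | IsSemisimpleRing (R ⧸ I.1)}.Finite) :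
    ∃ (ι : Type u) (M : ι → OpenIdeal R), IsRadicalDecomposition M := by
  obtain hcomm | hcount | hfin := habc
  · let : CommRing R := { ‹Ring R› with mul_comm := hcomm }
    exact ⟨_, _, isRadicalDecomposition_openFieldIdeal hbase hperf⟩
  · exact ⟨_, _, isRadicalDecomposition_of_isCountablyGenerated hbase hperf⟩
  · have := finite_openSimpleIdeal hperf hfin
    exact ⟨_, _, isRadicalDecomposition_of_finite hperf⟩

theorem proposition10p2 {R : Type u} [Ring R] [UniformSpace R] [IsUniformAddGroup R]
    [IsTopologicalRing R] [T2Space R] [CompleteSpace R]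
    -- open two-sided ideals form a base of neighborhoods of zero
    (hbase : ∀ U ∈ 𝓝 (0 : R), ∃ I : OpenIdeal R, (I.1 : Set R) ⊆ U)
    -- all discrete quotient rings are left perfect
    (hperf : ∀ I : OpenIdeal R, IsLeftPerfect (R ⧸ I.1))
    -- (a) `R` is commutative, or (b) `R` has a countable base of neighborhoods of zero, or
    -- (c) `R` has only finitely many semisimple Artinian discrete quotient rings
    (habc : (∀ x y : R, x * y = y * x) ∨ (𝓝 (0 : R)).IsCountablyGenerated ∨
      {I : OpenIdeal R | IsSemisimpleRing (R ⧸ I.1)}.Finite) :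
    (limJacobson R).IsTwoSided ∧
    IsTopologicallyLeftTNilpotent (limJacobson R) ∧
    IsStronglyClosed.{w} (limJacobson R).toAddSubgroup ∧
    (∃ (Γ : Type u) (S : Γ → Type u) (_ : ∀ γ, Ring (S γ)) (_ : ∀ γ, TopologicalSpace (S γ)),
      (∀ γ, DiscreteTopology (S γ) ∧ IsSimpleRing (S γ) ∧ IsArtinianRing (S γ)) ∧
      ∃ e : (R ⧸ limJacobson R) ≃+* (∀ γ, S γ), IsHomeomorph e) ∧
    -- the decomposition in the commutative case
    ((∀ x y : R, x * y = y * x) →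
      (∀ G : OpenFieldIdeal R, IsLocalRing (LocalPiece G)) ∧
      IsHomeomorph (toLocalPieces R) ∧
      toLocalPieces R '' (limJacobson R : Set R) =
        Set.pi Set.univ (fun G => (LocalPiece.residueKernel G : Set (LocalPiece G))) ∧
      ∃ e : (R ⧸ limJacobson R) ≃+* (∀ G : OpenFieldIdeal R, R ⧸ G.1.1),
        IsHomeomorph e ∧ ∀ r G, e (Ideal.Quotient.mk _ r) G = Ideal.Quotient.mk G.1.1 r) := by
  have hnhds := OpenIdeal.hasBasis_nhds_zero hbase
  obtain ⟨ι, M, hM⟩ := exists_isRadicalDecomposition hnhds hperf habc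
  obtain ⟨e, he, -⟩ := hM.exists_ringEquiv
  refine ⟨inferInstance, isTopologicallyLeftTNilpotent_limJacobson hnhds hperf,
    hM.isStronglyClosed,
    ⟨ι, fun i => R ⧸ (M i).1, inferInstance, inferInstance, fun i => ?_, e, he⟩, fun hcomm => ?_⟩
  · have := hM.isSimpleRing i
    exact ⟨inferInstance, this, (hperf (M i)).isArtinianRing_of_isSimpleRing⟩
  · let : CommRing R := { ‹Ring R› with mul_comm := hcomm }
    obtain ⟨e, he, hmk⟩ := (isRadicalDecomposition_openFieldIdeal hnhds hperf).exists_ringEquiv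
    exact ⟨LocalPiece.isLocalRing, isHomeomorph_toLocalPieces hnhds hperf,
      image_toLocalPieces_limJacobson hnhds hperf, e, he, fun r => congr_fun (hmk r)⟩
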